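/- For a finite group $G$ let $L(G)$ be the set of subgroups of $G$. For a subgroup $H$ of $G$ put $$sd(H,G)=\frac{1}{|L(H)|\,|L(G)|}\,\bigl|\{(H_1,G_1)\in L(H)\times L(G) : H_1G_1=G_1H_1\}\bigr|,$$ where $H_1G_1=\{hg : h\in H_1,\ g\in G_1\}$ and $G_1H_1=\{gh : g\in G_1,\ h\in H_1\}$. Let $\mathcal{C}$ be the class of finite groups $G$ for which the set $\{sd(H,G) : H\in L(G)\}$ has exactly two elements. Theorem. Let $G$ be a finite group with exactly one conjugacy class of non-normal subgroups. Then $G\in\mathcal{C}$ if and only if $G\cong S_3$. -/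

import Mathlib

open scoped Pointwise

namespace SubgroupCommutativity

/-- The set of pairs `(H₁, G₁) ∈ L(H) × L(G)` with `H₁ G₁ = G₁ H₁` (products of subsets of `G`).
The subgroups of `H` are regarded as the subgroups of `G` contained in `H`. -/
def commutingPairs {G : Type*} [Group G] (H : Subgroup G) : Set (Subgroup G × Subgroup G) :=
  {x | x.1 ≤ H ∧ (x.1 : Set G) * (x.2 : Set G) = (x.2 : Set G) * (x.1 : Set G)}

/-- The relative subgroup commutativity degree `sd(H, G)` of a subgroup `H` of a finite group. -/
noncomputable def sd {G : Type*} [Group G] (H : Subgroup G) : ℚ :=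
  ((commutingPairs H).ncard : ℚ) /
    (((Set.Iic H).ncard : ℚ) * (Nat.card (Subgroup G) : ℚ))

/-- The class of finite groups with exactly two relative subgroup commutativity degrees. -/
def HasTwoDegrees (G : Type*) [Group G] : Prop :=
  Finite G ∧ (Set.range (fun H : Subgroup G => sd H)).ncard = 2

/-- The conjugacy class `{g H g⁻¹ | g ∈ G}` of a subgroup `H`. -/
def conjClass {G : Type*} [Group G] (H : Subgroup G) : Set (Subgroup G) :=
  {K | ∃ g : G, K = H.map (MulAut.conj g).toMonoidHom}

/-- The number of conjugacy classes of non-normal subgroups of a finite group. -/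
noncomputable def gamma (G : Type*) [Group G] : ℕ :=
  {C : Set (Subgroup G) | ∃ H : Subgroup G, ¬ H.Normal ∧ C = conjClass H}.ncard

end SubgroupCommutativity

/-! Let `H` represent the class of non-normal subgroups. Write l for the number of subgroups, a and
k for the numbers of normal and non-normal ones, n for the number of proper subgroups of `H`, and c
for the number of subgroups permuting with `H`. Normal subgroups permute with everything and c is
constant on the class, so the degree of `H` is (nl + c)/((n+1)l) and that of G is (al + kc)/l². If c
= l, every degree is 1. Otherwise both differ from the degree 1 of the trivial subgroup, so two
degrees force them to agree, which means l = (n+1)k (`sd_eq_sd_top_iff`), or equivalently a = nk.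

When c < l, `H` is a self-normalizing cyclic Sylow subgroup, so k is its index and k ≥ 3. Burnside's
transfer theorem gives a minimal normal complement, whence a ≤ 2n + 1 (`ncard_normal_le`). Then nk ≤
2n + 1 gives n = 1 and k = 3: `H` has prime order and index 3, and the action on its cosets
identifies G with S₃. Conversely, order 6 gives n = 1 and a = k = 3, so the criterion holds. -/

namespace SubgroupCommutativity

/-! ### Counting permuting subgroups -/

variable {G : Type*} [Group G]

/-- The number of subgroups permuting with `A`. -/
noncomputable def permCount (A : Subgroup G) : ℕ :=
  {B : Subgroup G | (A : Set G) * B = B * A}.ncard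

/-- `H` is non-normal and every non-normal subgroup is a conjugate of `H`. -/
structure IsUniqueNonnormal (H : Subgroup G) : Prop where
  not_normal : ¬ H.Normal
  eq_map_conj : ∀ K : Subgroup G, ¬ K.Normal → ∃ g : G, K = H.map (MulAut.conj g).toMonoidHom

theorem mem_conjClass_self (H : Subgroup G) : H ∈ conjClass H :=
  ⟨1, by ext x; simp⟩

theorem exists_isUniqueNonnormal (h : gamma G = 1) : ∃ H : Subgroup G, IsUniqueNonnormal H := by
  obtain ⟨C, hC⟩ := Set.ncard_eq_one.1 h
  have hmem : C ∈ {C : Set (Subgroup G) | ∃ H : Subgroup G, ¬ H.Normal ∧ C = conjClass H} := by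
    rw [hC]; rfl
  obtain ⟨H, hH, rfl⟩ := hmem
  refine ⟨H, hH, fun K hK => ?_⟩
  have : conjClass K ∈ ({conjClass H} : Set (Set (Subgroup G))) := hC ▸ ⟨K, hK, rfl⟩
  have hK' := mem_conjClass_self K
  rwa [Set.mem_singleton_iff.1 this] at hK'

theorem permCount_of_normal (A : Subgroup G) [A.Normal] :
    permCount A = Nat.card (Subgroup G) := by
  rw [permCount, ← Set.ncard_univ]
  congr 1
  exact Set.eq_univ_of_forall fun B => (Subgroup.set_mul_normal_comm (B : Set G) A).symm

/-- An automorphism permutes the subgroups and preserves the relation of permuting; applied to inner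
automorphisms, this makes `permCount` a class invariant. -/
theorem permCount_map (A : Subgroup G) (φ : MulAut G) :
    permCount (A.map φ.toMonoidHom) = permCount A := by
  have hφ : Function.Injective φ := φ.injective
  have himg : {B : Subgroup G | (A.map φ.toMonoidHom : Set G) * B = B * A.map φ.toMonoidHom} =
      Subgroup.map φ.toMonoidHom '' {B : Subgroup G | (A : Set G) * B = B * A} := by
    have key : ∀ B : Subgroup G, ((A.map φ.toMonoidHom : Set G) * B.map φ.toMonoidHom =
        B.map φ.toMonoidHom * A.map φ.toMonoidHom) ↔ (A : Set G) * B = B * A := by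
      intro B
      simp only [Subgroup.coe_map, ← Set.image_mul]
      exact (Set.image_injective.2 hφ).eq_iff
    ext B
    have hB : (B.comap φ.toMonoidHom).map φ.toMonoidHom = B :=
      Subgroup.map_comap_eq_self_of_surjective φ.surjective B
    constructor
    · intro h
      refine ⟨B.comap φ.toMonoidHom, (key _).1 ?_, hB⟩
      rw [hB]; exact h
    · rintro ⟨B, h, rfl⟩
      exact (key B).2 h
  rw [permCount, himg, Set.ncard_image_of_injective _ (Subgroup.map_injective hφ)]
  rfl

open Classical in
theorem ncard_commutingPairs [Fintype (Subgroup G)] (K : Subgroup G) :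
    (commutingPairs K).ncard = ∑ A with A ≤ K, permCount A := by
  rw [Set.ncard_eq_toFinset_card', Finset.card_eq_sum_card_fiberwise
    (f := Prod.fst) (t := {A | A ≤ K})]
  · refine Finset.sum_congr rfl fun A hA => ?_
    rw [permCount, Set.ncard_eq_toFinset_card']
    refine Finset.card_bij (fun x _ => x.2) ?_ ?_ ?_
    · rintro ⟨a, b⟩ h
      rw [Finset.mem_filter, Set.mem_toFinset] at h
      obtain ⟨⟨_, h⟩, rfl⟩ := h
      exact Set.mem_toFinset.2 h
    · rintro ⟨a, b⟩ h ⟨a', b'⟩ h' hb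
      simp only [Finset.mem_filter] at h h'
      exact Prod.ext (h.2.trans h'.2.symm) hb
    · intro b hb
      simp only [Finset.mem_filter, Finset.mem_univ, true_and] at hA
      rw [Set.mem_toFinset] at hb
      have hb' : (A : Set G) * b = b * A := hb
      exact ⟨(A, b), Finset.mem_filter.2 ⟨Set.mem_toFinset.2 ⟨hA, hb'⟩, rfl⟩, rfl⟩
  · rintro ⟨a, b⟩ h
    simp only [Set.coe_toFinset] at h
    simpa using h.1

namespace IsUniqueNonnormal

variable {H : Subgroup G}

theorem ne_bot (hH : IsUniqueNonnormal H) : H ≠ ⊥ := by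
  rintro rfl
  exact hH.not_normal inferInstance

theorem ne_top (hH : IsUniqueNonnormal H) : H ≠ ⊤ := by
  rintro rfl
  exact hH.not_normal inferInstance

theorem permCount_eq (hH : IsUniqueNonnormal H) {A : Subgroup G} (hA : ¬ A.Normal) :
    permCount A = permCount H := by
  obtain ⟨g, rfl⟩ := hH.eq_map_conj A hA
  exact permCount_map H _

theorem of_not_normal (hH : IsUniqueNonnormal H) {A : Subgroup G} (hA : ¬ A.Normal) :
    IsUniqueNonnormal A := by
  refine ⟨hA, fun K hK => ?_⟩
  obtain ⟨a, rfl⟩ := hH.eq_map_conj A hA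
  obtain ⟨k, rfl⟩ := hH.eq_map_conj K hK
  refine ⟨k * a⁻¹, ?_⟩
  rw [Subgroup.map_map]
  congr 1
  ext x
  simp [mul_assoc]

theorem card_eq (hH : IsUniqueNonnormal H) {A : Subgroup G} (hA : ¬ A.Normal) :
    Nat.card A = Nat.card H := by
  obtain ⟨g, rfl⟩ := hH.eq_map_conj A hA
  exact (Nat.card_congr (H.equivMapOfInjective _ (MulAut.conj g).injective).toEquiv).symm

end IsUniqueNonnormal

/-! ### Formulas for the degrees -/

section Finite

variable [Finite G]

theorem card_subgroup_pos : 0 < Nat.card (Subgroup G) := Nat.card_pos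

theorem ncard_Iic_pos (K : Subgroup G) : 0 < (Set.Iic K).ncard :=
  (Set.ncard_pos).2 ⟨K, le_refl K⟩

theorem sd_eq_one_of_permCount {K : Subgroup G}
    (h : ∀ A ≤ K, permCount A = Nat.card (Subgroup G)) : sd K = 1 := by
  classical
  have := Fintype.ofFinite (Subgroup G)
  have hs : (commutingPairs K).ncard = (Set.Iic K).ncard * Nat.card (Subgroup G) := by
    rw [ncard_commutingPairs, Finset.sum_congr rfl (g := fun _ => Nat.card (Subgroup G)),
      Finset.sum_const, smul_eq_mul, Set.ncard_eq_toFinset_card']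
    · congr 2
      ext; simp
    · intro A hA
      exact h A (by simpa using hA)
  have h1 := card_subgroup_pos (G := G)
  have h2 := ncard_Iic_pos K
  rw [sd, hs]
  push_cast
  exact div_self (by positivity)

theorem sd_eq_one {K : Subgroup G} (h : ∀ A ≤ K, A.Normal) : sd K = 1 :=
  sd_eq_one_of_permCount fun A hA => have := h A hA; permCount_of_normal A

theorem sd_of_forall_lt_normal {H : Subgroup G} (h : ∀ A < H, A.Normal) :
    sd H = (((Set.Iio H).ncard : ℚ) * Nat.card (Subgroup G) + permCount H) /
      (((Set.Iio H).ncard + 1) * Nat.card (Subgroup G)) := by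
  classical
  have := Fintype.ofFinite (Subgroup G)
  have hI : (Set.Iic H).ncard = (Set.Iio H).ncard + 1 := by
    rw [← Set.Iio_insert, Set.ncard_insert_of_notMem (by simp)]
  have hF : (Finset.univ.filter (fun A : Subgroup G => A ≤ H)) =
      insert H (Finset.univ.filter (fun A : Subgroup G => A < H)) := by
    ext A; simp [le_iff_eq_or_lt]
  have hs : (commutingPairs H).ncard =
      (Set.Iio H).ncard * Nat.card (Subgroup G) + permCount H := by
    rw [ncard_commutingPairs, hF, Finset.sum_insert (by simp), add_comm,
      Finset.sum_congr rfl (g := fun _ => Nat.card (Subgroup G)),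
      Finset.sum_const, smul_eq_mul, Set.ncard_eq_toFinset_card']
    · congr 3
      ext; simp
    · intro A hA
      have := h A (by simpa using hA)
      exact permCount_of_normal A
  rw [sd, hs, hI]
  push_cast
  rfl

variable (G) in
theorem ncard_normal_add_ncard_not_normal :
    {K : Subgroup G | K.Normal}.ncard + {K : Subgroup G | ¬ K.Normal}.ncard =
      Nat.card (Subgroup G) := by
  have := Set.ncard_add_ncard_compl {K : Subgroup G | K.Normal}
  rwa [Set.compl_ofPred] at this

theorem ncard_commutingPairs_top (c : ℕ) (hc : ∀ A : Subgroup G, ¬ A.Normal → permCount A = c) :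
    (commutingPairs (⊤ : Subgroup G)).ncard =
      {K : Subgroup G | K.Normal}.ncard * Nat.card (Subgroup G) +
        {K : Subgroup G | ¬ K.Normal}.ncard * c := by
  classical
  have := Fintype.ofFinite (Subgroup G)
  rw [ncard_commutingPairs, ← Finset.sum_filter_add_sum_filter_not _ Subgroup.Normal,
    Set.ncard_eq_toFinset_card', Set.ncard_eq_toFinset_card',
    Finset.sum_congr rfl (g := fun _ => Nat.card (Subgroup G)),
    Finset.sum_const, smul_eq_mul,
    Finset.sum_congr rfl (g := fun _ => c) fun A hA => hc A (Finset.mem_filter.1 hA).2,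
    Finset.sum_const, smul_eq_mul]
  · congr 3 <;> (ext; simp)
  · intro A hA
    have := (Finset.mem_filter.1 hA).2
    exact permCount_of_normal A

namespace IsUniqueNonnormal

variable {H : Subgroup G}

/-- All non-normal subgroups are conjugate, hence of equal order, so none contains another properly.
-/
theorem normal_of_lt (hH : IsUniqueNonnormal H) {A : Subgroup G} (hA : A < H) : A.Normal := by
  by_contra h
  exact hA.ne (Subgroup.eq_of_le_of_card_ge hA.le (hH.card_eq h).ge)

theorem normal_of_gt (hH : IsUniqueNonnormal H) {A : Subgroup G} (hA : H < A) : A.Normal := by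
  by_contra h
  exact hA.ne (Subgroup.eq_of_le_of_card_ge hA.le (hH.card_eq h).le)

/-- If `H` fails to permute with some subgroup, the degrees of `H` and `G` agree exactly when
`|L(G)|` is the product of `|L(H)|` and the number of conjugates of `H`. -/
theorem sd_eq_sd_top_iff (hH : IsUniqueNonnormal H) (hc : permCount H < Nat.card (Subgroup G)) :
    sd H = sd (⊤ : Subgroup G) ↔ Nat.card (Subgroup G) =
      ((Set.Iio H).ncard + 1) * {K : Subgroup G | ¬ K.Normal}.ncard := by
  have h1 := card_subgroup_pos (G := G)
  rw [sd_of_forall_lt_normal fun A hA => hH.normal_of_lt hA, sd,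
    ncard_commutingPairs_top _ fun A hA => hH.permCount_eq hA, Set.Iic_top, Set.ncard_univ]
  have h2 := ncard_normal_add_ncard_not_normal G
  generalize {K : Subgroup G | K.Normal}.ncard = a at *
  generalize {K : Subgroup G | ¬ K.Normal}.ncard = k at *
  generalize Nat.card (Subgroup G) = l at *
  generalize (Set.Iio H).ncard = n at *
  generalize permCount H = c at *
  have hl : (l : ℚ) ≠ 0 := by positivity
  have hlc : (l : ℚ) - c ≠ 0 := by
    have : (c : ℚ) < l := by exact_mod_cast hc
    linarith
  have ha : (a : ℚ) = l - k := by rw [← h2]; push_cast; ring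
  rw [div_eq_div_iff (by positivity) (by positivity), ← Nat.cast_inj (R := ℚ)]
  push_cast
  rw [ha, ← sub_eq_zero, ← sub_eq_zero (b := ((n : ℚ) + 1) * k)]
  -- The cross-multiplied difference factors; the first factor is nonzero since c < l, which leaves
  -- l = (n+1)k.
  have : ((n : ℚ) * l + c) * (l * l) - ((l - k) * l + k * c) * ((n + 1) * l) =
      -(l * (l - c)) * (l - (n + 1) * k) := by ring
  rw [this]
  simp [hl, hlc]

theorem sd_eq_one_iff (hH : IsUniqueNonnormal H) :
    sd H = 1 ↔ permCount H = Nat.card (Subgroup G) := by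
  have h1 := card_subgroup_pos (G := G)
  rw [sd_of_forall_lt_normal fun A hA => hH.normal_of_lt hA, div_eq_one_iff_eq (by positivity),
    add_mul, one_mul, add_right_inj, Nat.cast_inj]

theorem sd_top_eq_one_iff (hH : IsUniqueNonnormal H) :
    sd (⊤ : Subgroup G) = 1 ↔ permCount H = Nat.card (Subgroup G) := by
  have h1 := card_subgroup_pos (G := G)
  have hk : 0 < {K : Subgroup G | ¬ K.Normal}.ncard := (Set.ncard_pos).2 ⟨H, hH.not_normal⟩
  rw [sd, ncard_commutingPairs_top _ fun A hA => hH.permCount_eq hA, Set.Iic_top, Set.ncard_univ,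
    div_eq_one_iff_eq (by positivity)]
  have h2 := ncard_normal_add_ncard_not_normal G
  norm_cast
  conv_lhs => rhs; lhs; rw [← h2]
  rw [add_mul, add_right_inj]
  exact mul_right_inj' hk.ne'

end IsUniqueNonnormal

/-! ### Structure of the non-normal subgroup and its normal complement -/

namespace IsUniqueNonnormal

variable {H : Subgroup G}

/-- Otherwise each element of `H` generates a proper, hence normal, subgroup, and `H` would be
closed under conjugation. -/
theorem exists_zpowers_eq (hH : IsUniqueNonnormal H) : ∃ x : G, Subgroup.zpowers x = H := by
  by_contra! h
  refine hH.not_normal ⟨fun x hx g => ?_⟩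
  have hle : Subgroup.zpowers x ≤ H := Subgroup.zpowers_le.2 hx
  have := hH.normal_of_lt (lt_of_le_of_ne hle (h x))
  exact hle (this.conj_mem x (Subgroup.mem_zpowers x) g)

/-- If distinct primes p and q divided the order of a generator x, then `H` would be the join of the
normal subgroups generated by x^p and x^q, by Bézout. -/
theorem isPrimePow_card (hH : IsUniqueNonnormal H) : IsPrimePow (Nat.card H) := by
  obtain ⟨x, rfl⟩ := hH.exists_zpowers_eq
  rw [Nat.card_zpowers, isPrimePow_iff_unique_prime_dvd]
  have hx1 : orderOf x ≠ 1 := by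
    rw [Ne, orderOf_eq_one_iff]
    rintro rfl
    exact hH.ne_bot (by simp)
  obtain ⟨p, hp, hpx⟩ := Nat.exists_prime_and_dvd hx1
  refine ⟨p, ⟨hp, hpx⟩, ?_⟩
  rintro q ⟨hq, hqx⟩
  by_contra hne
  have hnorm : ∀ r : ℕ, r.Prime → r ∣ orderOf x → (Subgroup.zpowers (x ^ r)).Normal := by
    intro r hr hrx
    by_contra h
    have hcard := hH.card_eq h
    rw [Nat.card_zpowers, Nat.card_zpowers, orderOf_pow_of_dvd hr.ne_zero hrx] at hcard
    exact (Nat.div_lt_self (orderOf_pos x) hr.one_lt).ne hcard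
  have h1 := hnorm p hp hpx
  have h2 := hnorm q hq hqx
  refine hH.not_normal ?_
  convert Subgroup.sup_normal (Subgroup.zpowers (x ^ p)) (Subgroup.zpowers (x ^ q)) using 1
  apply le_antisymm
  · rw [Subgroup.zpowers_le]
    have hb : (p : ℤ) * Nat.gcdA p q + q * Nat.gcdB p q = 1 := by
      rw [← Nat.gcd_eq_gcd_ab, (Nat.coprime_primes hp hq).2 (Ne.symm hne)]; rfl
    have hx : x = (x ^ p) ^ (Nat.gcdA p q) * (x ^ q) ^ (Nat.gcdB p q) := by
      rw [← zpow_natCast x p, ← zpow_natCast x q, ← zpow_mul, ← zpow_mul, ← zpow_add, hb, zpow_one]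
    have hmem := Subgroup.mul_mem_sup (Subgroup.zpow_mem_zpowers (x ^ p) (Nat.gcdA p q))
      (Subgroup.zpow_mem_zpowers (x ^ q) (Nat.gcdB p q))
    rwa [← hx] at hmem
  · rw [sup_le_iff, Subgroup.zpowers_le, Subgroup.zpowers_le]
    exact ⟨Subgroup.npow_mem_zpowers _ _, Subgroup.npow_mem_zpowers _ _⟩

/-- A unique non-normal subgroup that does not permute with all subgroups is self-normalizing. -/
theorem normalizer_eq (hH : IsUniqueNonnormal H) (hc : permCount H ≠ Nat.card (Subgroup G)) :
    Subgroup.normalizer (H : Set G) = H := by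
  by_contra hne
  have hlt : H < Subgroup.normalizer (H : Set G) :=
    lt_of_le_of_ne Subgroup.le_normalizer (Ne.symm hne)
  have hN := hH.normal_of_gt hlt
  refine hc ?_
  rw [permCount, ← Set.ncard_univ]
  congr 1
  refine Set.eq_univ_of_forall fun B => ?_
  by_cases hB : B.Normal
  · exact Subgroup.set_mul_normal_comm (H : Set G) B
  obtain ⟨g, rfl⟩ := hH.eq_map_conj B hB
  -- The normalizer is itself normal, so it contains every conjugate of `H`; a subgroup normalizing
  -- `H` permutes with it.
  have hle : ∀ b ∈ H.map (MulAut.conj g).toMonoidHom, b ∈ Subgroup.normalizer (H : Set G) := by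
    rintro _ ⟨y, hy, rfl⟩
    exact hN.conj_mem y (Subgroup.le_normalizer hy) g
  ext z
  constructor
  · rintro ⟨a, ha, b, hb, rfl⟩
    refine ⟨b, hb, b⁻¹ * a * b, ?_, by simp [mul_assoc]⟩
    have := (Subgroup.mem_normalizer_iff.1 (inv_mem (hle b hb)) a).1 ha
    simpa using this
  · rintro ⟨b, hb, a, ha, rfl⟩
    exact ⟨b * a * b⁻¹, (Subgroup.mem_normalizer_iff.1 (hle b hb) a).1 ha, b, hb, by simp⟩

/-- A p-subgroup that is not Sylow has index in its normalizer divisible by p, which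
self-normalization excludes. -/
theorem exists_sylow (hH : IsUniqueNonnormal H) (hN : Subgroup.normalizer (H : Set G) = H) :
    ∃ p : ℕ, p.Prime ∧ ∃ P : Sylow p G, (P : Subgroup G) = H := by
  obtain ⟨p, n, hp, hn, hcard⟩ := hH.isPrimePow_card
  have hp : p.Prime := hp.nat_prime
  have : Fact p.Prime := ⟨hp⟩
  refine ⟨p, hp, (IsPGroup.of_card hcard.symm).toSylow fun hdvd => ?_, rfl⟩
  have h1 : p ^ (n + 1) ∣ Nat.card G := by
    rw [← H.card_mul_index, ← hcard, pow_succ]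
    exact mul_dvd_mul_left _ hdvd
  have h2 := Sylow.prime_pow_dvd_card_normalizer h1 hcard.symm
  rw [hN, ← hcard] at h2
  exact (Nat.pow_lt_pow_right hp.one_lt n.lt_succ_self).not_ge
    (Nat.le_of_dvd (pow_pos hp.pos _) h2)

/-- The non-normal subgroups are exactly the Sylow p-subgroups, and their number is the index of the
normalizer, here `H` itself. -/
theorem ncard_not_normal (hH : IsUniqueNonnormal H)
    (hN : Subgroup.normalizer (H : Set G) = H) :
    {K : Subgroup G | ¬ K.Normal}.ncard = H.index := by
  obtain ⟨p, hp, P, hP⟩ := hH.exists_sylow hN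
  have : Fact p.Prime := ⟨hp⟩
  have hidx := Sylow.card_eq_index_normalizer P
  rw [← Sylow.coe_coe, hP, hN] at hidx
  rw [← hidx, ← Set.ncard_univ, ← Set.ncard_image_of_injective (f := fun Q : Sylow p G => Q.1)
    Set.univ fun Q R h => Sylow.ext h]
  congr 1
  have hmap : ∀ g : G, ((g • P : Sylow p G) : Subgroup G) =
      H.map (MulAut.conj g).toMonoidHom := fun g => by
    rw [Sylow.coe_subgroup_smul, hP]; rfl
  ext K
  constructor
  · intro hK
    obtain ⟨g, rfl⟩ := hH.eq_map_conj K hK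
    exact ⟨g • P, trivial, hmap g⟩
  · rintro ⟨Q, -, rfl⟩ (hQ : Q.1.Normal)
    obtain ⟨g, hg⟩ := MulAction.exists_smul_eq G Q P
    refine hH.not_normal ?_
    rw [← hP, ← hg, Sylow.coe_subgroup_smul, Subgroup.Normal.conj_smul_eq_self]
    exact hQ

/-- Frattini argument: a larger `K` is normal and contains the Sylow subgroup `H`, so G is the join
of the normalizer of `H` and `K`, which is `K`. -/
theorem eq_top_of_lt (hH : IsUniqueNonnormal H) (hN : Subgroup.normalizer (H : Set G) = H)
    {K : Subgroup G} (hK : H < K) : K = ⊤ := by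
  obtain ⟨p, hp, P, hP⟩ := hH.exists_sylow hN
  have : Fact p.Prime := ⟨hp⟩
  have := hH.normal_of_gt hK
  have h := Sylow.normalizer_sup_eq_top' (N := K) P (hP ▸ hK.le)
  rwa [← Sylow.coe_coe, hP, hN, sup_eq_right.2 hK.le] at h

theorem eq_top_of_normal_of_le (hH : IsUniqueNonnormal H)
    (hN : Subgroup.normalizer (H : Set G) = H) {K : Subgroup G} (hK : K.Normal) (hle : H ≤ K) :
    K = ⊤ :=
  hH.eq_top_of_lt hN (lt_of_le_of_ne hle fun h => hH.not_normal (h ▸ hK))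

/-- A self-normalizing unique non-normal subgroup has a minimal normal complement, and every normal
subgroup meeting that complement trivially is contained in `H`. -/
theorem exists_complement (hH : IsUniqueNonnormal H)
    (hN : Subgroup.normalizer (H : Set G) = H) :
    ∃ N : Subgroup G, N.Normal ∧ N.IsComplement' H ∧ (∀ A ≤ N, A = ⊥ ∨ A = N) ∧
      ∀ K : Subgroup G, K.Normal → K ⊓ N = ⊥ → K ≤ H := by
  obtain ⟨p, hp, P, hP⟩ := hH.exists_sylow hN
  have : Fact p.Prime := ⟨hp⟩
  -- Burnside's hypothesis: `P` is its own normalizer and is cyclic, hence abelian. The complement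
  -- is then the kernel of the transfer.
  have hcent : Subgroup.normalizer (P : Set G) ≤ Subgroup.centralizer (P : Set G) := by
    obtain ⟨x, hx⟩ := hH.exists_zpowers_eq
    have e : (P : Set G) = (H : Set G) := congrArg (fun K : Subgroup G => (K : Set G)) hP
    rw [e, hN, ← hx]
    exact Subgroup.le_centralizer _
  have hcomp : (MonoidHom.transferSylow P hcent).ker.IsComplement' H := by
    have aux : ∀ K : Subgroup G, K.IsComplement' P → K.IsComplement' H := fun K h => hP ▸ h
    exact aux _ (MonoidHom.ker_transferSylow_isComplement' P hcent)
  set f := MonoidHom.transferSylow P hcent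
  have hdisj : f.ker ⊓ H = ⊥ := hcomp.disjoint.eq_bot
  refine ⟨f.ker, inferInstance, hcomp, fun A hA => ?_, fun K hK hKN => ?_⟩
  · by_cases hAn : A.Normal
    · rcases eq_or_ne A ⊥ with h | h
      · exact Or.inl h
      -- A nontrivial normal `A` inside the complement satisfies AH = G by maximality of `H`;
      -- Dedekind's law then gives `A = f.ker`.
      right
      have hlt : H < A ⊔ H := by
        refine lt_of_le_of_ne le_sup_right fun he => h ?_
        rw [eq_bot_iff, ← hdisj]
        exact le_inf hA (sup_eq_right.1 he.symm)
      have htop := hH.eq_top_of_lt hN hlt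
      have hmod := Subgroup.normal_mul A H
      apply le_antisymm hA
      intro x hx
      have hx' : x ∈ ((A ⊔ H : Subgroup G) : Set G) := by rw [htop]; trivial
      rw [hmod] at hx'
      obtain ⟨a, ha, b, hb, rfl⟩ := hx'
      have hb' : b ∈ f.ker ⊓ H := ⟨(Subgroup.mul_mem_cancel_left _ (hA ha)).1 hx, hb⟩
      rw [hdisj, Subgroup.mem_bot] at hb'
      simpa [hb'] using ha
    -- A non-normal `A` is a conjugate of `H`; as the kernel is normal it would contain `H`, which
    -- it meets trivially.
    · exfalso
      obtain ⟨g, rfl⟩ := hH.eq_map_conj A hAn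
      apply hH.ne_bot
      rw [eq_bot_iff, ← hdisj]
      refine le_inf (fun y hy => ?_) le_rfl
      have h1 : g * y * g⁻¹ ∈ f.ker := hA ⟨y, hy, rfl⟩
      simpa [mul_assoc] using (MonoidHom.normal_ker f).conj_mem _ h1 g⁻¹
  -- The transfer embeds `K` into `P`, so `K` is a normal p-subgroup and lies in every Sylow
  -- p-subgroup.
  · have hpK : IsPGroup p K := by
      refine P.isPGroup'.of_injective (f.comp K.subtype) ?_
      rw [injective_iff_map_eq_one]
      rintro ⟨k, hk⟩ h
      have : k ∈ K ⊓ f.ker := ⟨hk, h⟩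
      rw [hKN, Subgroup.mem_bot] at this
      exact Subtype.ext this
    have hpH : IsPGroup p H := hP ▸ P.isPGroup'
    have := P.is_maximal' (hpH.to_sup_of_normal_right hpK) (hP ▸ le_sup_left)
    rw [hP] at this
    exact sup_eq_left.1 this

/-- With `N` the minimal normal complement, a proper normal `K` either meets `N` trivially and lies
properly in `H`, or contains `N` and equals `N ⊔ (H ⊓ K)`. Each case allows at most one `K` per
proper subgroup of `H`, and the extra 1 is the whole group. -/
theorem ncard_normal_le (hH : IsUniqueNonnormal H)
    (hN : Subgroup.normalizer (H : Set G) = H) :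
    {K : Subgroup G | K.Normal}.ncard ≤ 2 * (Set.Iio H).ncard + 1 := by
  obtain ⟨N, hNn, hcomp, hmin, hle⟩ := hH.exists_complement hN
  have hsub : {K : Subgroup G | K.Normal} ⊆
      insert ⊤ (Set.Iio H ∪ (fun A => N ⊔ A) '' Set.Iio H) := by
    intro K (hK : K.Normal)
    rw [Set.mem_insert_iff, or_iff_not_imp_left]
    intro hKtop
    have hlt : ∀ A : Subgroup G, A ≤ H → A ≤ K → A < H := fun A h1 h2 =>
      lt_of_le_of_ne h1 fun h => hKtop (hH.eq_top_of_normal_of_le hN hK (h ▸ h2))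
    rcases hmin (K ⊓ N) inf_le_right with h | h
    · exact Or.inl (hlt K (hle K hK h) le_rfl)
    · refine Or.inr ⟨H ⊓ K, hlt _ inf_le_left inf_le_right, ?_⟩
      have hNK : N ≤ K := inf_eq_right.1 h
      have h1 := Subgroup.normal_mul N H
      rw [hcomp.sup_eq_top] at h1
      refine le_antisymm (sup_le hNK inf_le_right) fun x hx => ?_
      have hx' : x ∈ ((⊤ : Subgroup G) : Set G) := trivial
      rw [h1] at hx'
      obtain ⟨a, ha, b, hb, rfl⟩ := hx'
      exact Subgroup.mul_mem_sup ha ⟨hb, (Subgroup.mul_mem_cancel_left _ (hNK ha)).1 hx⟩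
  refine (Set.ncard_le_ncard hsub).trans ((Set.ncard_insert_le _ _).trans ?_)
  have h1 := Set.ncard_union_le (Set.Iio H) ((fun A => N ⊔ A) '' Set.Iio H)
  have h2 := Set.ncard_image_le (f := fun A => N ⊔ A) (Set.toFinite (Set.Iio H))
  omega

theorem three_le_index (hH : IsUniqueNonnormal H) : 3 ≤ H.index := by
  have h0 : H.index ≠ 0 := Subgroup.index_ne_zero_of_finite
  have h1 : H.index ≠ 1 := fun h => hH.ne_top (Subgroup.index_eq_one.1 h)
  have h2 : H.index ≠ 2 := fun h => hH.not_normal (Subgroup.normal_of_index_eq_two h)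
  omega

theorem ncard_Iio_pos (hH : IsUniqueNonnormal H) : 0 < (Set.Iio H).ncard :=
  (Set.ncard_pos).2 ⟨⊥, bot_lt_iff_ne_bot.2 hH.ne_bot⟩

end IsUniqueNonnormal

end Finite

end SubgroupCommutativity

/-! ### Recognition of S₃ and the two implications -/

namespace SubgroupCommutativity

variable {G : Type*} [Group G]

theorem coe_sup_of_mul_comm {A B : Subgroup G} (h : (A : Set G) * B = B * A) :
    ((A ⊔ B : Subgroup G) : Set G) = (A : Set G) * B := by
  let S : Subgroup G :=
    { carrier := (A : Set G) * B
      one_mem' := ⟨1, A.one_mem, 1, B.one_mem, one_mul 1⟩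
      mul_mem' := by
        intro x y hx hy
        have hxy : x * y ∈ ((A : Set G) * B) * ((A : Set G) * B) := Set.mul_mem_mul hx hy
        rwa [mul_assoc, ← mul_assoc (B : Set G), ← h, mul_assoc (A : Set G) B B, coe_mul_coe,
          ← mul_assoc, coe_mul_coe] at hxy
      inv_mem' := by
        rintro _ ⟨a, ha, b, hb, rfl⟩
        rw [h]
        exact ⟨b⁻¹, B.inv_mem hb, a⁻¹, A.inv_mem ha, (mul_inv_rev a b).symm⟩ }
  have hle : A ⊔ B ≤ S := sup_le (fun a ha => ⟨a, ha, 1, B.one_mem, mul_one a⟩)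
    fun b hb => ⟨1, A.one_mem, b, hb, one_mul b⟩
  refine Set.Subset.antisymm hle ?_
  rintro _ ⟨a, ha, b, hb, rfl⟩
  exact Subgroup.mul_mem_sup ha hb

/-- A finite group acts faithfully on the cosets of a non-normal subgroup with no proper nontrivial
subgroups; if the index is `3`, the group is the symmetric group of degree `3`. -/
theorem nonempty_mulEquiv_perm_of_index_eq_three [Finite G] {H : Subgroup G} (hH : ¬ H.Normal)
    (hidx : H.index = 3) (hsimple : ∀ A < H, A = ⊥) : Nonempty (G ≃* Equiv.Perm (Fin 3)) := by
  -- The trivial core makes the action on the three cosets faithful. Since the order of G is a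
  -- multiple of 3, at least 6 and at most 6, the embedding is bijective.
  have hcore : H.normalCore = ⊥ :=
    hsimple _ (lt_of_le_of_ne H.normalCore_le fun h => hH (h ▸ H.normalCore_normal))
  have hinj : Function.Injective (MulAction.toPermHom G (G ⧸ H)) := by
    rw [← MonoidHom.ker_eq_bot_iff, ← Subgroup.normalCore_eq_ker, hcore]
  have hq : Nat.card (G ⧸ H) = 3 := by rw [← Subgroup.index_eq_card, hidx]
  have hperm : Nat.card (Equiv.Perm (G ⧸ H)) = 6 := by rw [Nat.card_perm, hq]; rfl
  have hle := Nat.card_le_card_of_injective _ hinj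
  have hcard := H.card_mul_index
  rw [hidx] at hcard
  have hne : Nat.card H ≠ 1 := fun h => hH (by
    rw [Subgroup.card_eq_one] at h
    rw [h]; infer_instance)
  have hpos : 0 < Nat.card H := Nat.card_pos
  have hG : Nat.card G = Nat.card (Equiv.Perm (G ⧸ H)) := by omega
  have hbij := (Nat.bijective_iff_injective_and_card _).2 ⟨hinj, hG⟩
  exact ⟨(MulEquiv.ofBijective _ hbij).trans (Finite.equivFinOfCardEq hq).permCongrHom⟩

section Finite

variable [Finite G] {H : Subgroup G}

theorem nonempty_mulEquiv_perm_of_hasTwoDegrees (hH : IsUniqueNonnormal H)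
    (h : HasTwoDegrees G) : Nonempty (G ≃* Equiv.Perm (Fin 3)) := by
  have hbot : sd (⊥ : Subgroup G) = 1 := sd_eq_one fun A hA => by
    rw [le_bot_iff.1 hA]; infer_instance
  obtain ⟨x, y, -, hr⟩ := Set.ncard_eq_two.1 h.2
  have hval : ∀ K : Subgroup G, sd K = x ∨ sd K = y := fun K => by
    have : sd K ∈ ({x, y} : Set ℚ) := hr ▸ ⟨K, rfl⟩
    simpa using this
  have hc : permCount H ≠ Nat.card (Subgroup G) := by
    intro hc
    have hone : ∀ K : Subgroup G, sd K = 1 := fun K => sd_eq_one_of_permCount fun A _ => by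
      by_cases hA : A.Normal
      · exact permCount_of_normal A
      · rw [hH.permCount_eq hA, hc]
    have h2 := h.2
    simp [hone] at h2
  have hN := hH.normalizer_eq hc
  have hlt : permCount H < Nat.card (Subgroup G) := by
    refine lt_of_le_of_ne ?_ hc
    rw [← Set.ncard_univ]
    exact Set.ncard_le_ncard (Set.subset_univ _)
  have h1 := hbot ▸ hval ⊥
  have h2 := hval H
  have h3 := hval ⊤
  have h4 : sd H ≠ 1 := fun h => hc (hH.sd_eq_one_iff.1 h)
  have h5 : sd (⊤ : Subgroup G) ≠ 1 := fun h => hc (hH.sd_top_eq_one_iff.1 h)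
  -- One of the two values is 1, so the degrees of `H` and `⊤`, both different from 1, coincide.
  have heq := (hH.sd_eq_sd_top_iff hlt).1 (by grind)
  rw [← ncard_normal_add_ncard_not_normal, hH.ncard_not_normal hN] at heq
  have hle := hH.ncard_normal_le hN
  have hk := hH.three_le_index
  have hn := hH.ncard_Iio_pos
  -- From a + k = (n+1)k, a ≤ 2n + 1 and k ≥ 3 it follows that 3n ≤ 2n + 1. With n = 1, a = k ≤ 3
  -- then gives index 3.
  have hn1 : (Set.Iio H).ncard = 1 := by nlinarith
  rw [hn1] at heq hle
  refine nonempty_mulEquiv_perm_of_index_eq_three hH.not_normal (by omega) fun A hA => ?_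
  obtain ⟨B, hB⟩ := Set.ncard_eq_one.1 hn1
  have hA' : A ∈ ({B} : Set (Subgroup G)) := hB ▸ hA
  have hb : ⊥ ∈ ({B} : Set (Subgroup G)) := hB ▸ bot_lt_iff_ne_bot.2 hH.ne_bot
  rw [Set.mem_singleton_iff] at hA' hb
  rw [hA', hb]

theorem IsUniqueNonnormal.card_eq_two (hH : IsUniqueNonnormal H) (hG : Nat.card G = 6) :
    Nat.card H = 2 ∧ H.index = 3 := by
  have h3 := hH.three_le_index
  have hmul := H.card_mul_index
  rw [hG] at hmul
  have h1 : Nat.card H ≠ 1 := fun h => hH.ne_bot (Subgroup.card_eq_one.1 h)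
  have h0 : 0 < Nat.card H := Nat.card_pos
  have : Nat.card H = 2 := by
    by_contra hne
    have : 3 ≤ Nat.card H := by omega
    nlinarith
  rw [this] at hmul
  omega

theorem IsUniqueNonnormal.sd_eq_of_card_eq_six (hH : IsUniqueNonnormal H) (hG : Nat.card G = 6) :
    (∀ K : Subgroup G, H < K → K = ⊤) ∧ sd H = sd (⊤ : Subgroup G) ∧ sd (⊤ : Subgroup G) ≠ 1 := by
  obtain ⟨hcard, hidx⟩ := hH.card_eq_two hG
  have hprime : Fact (Nat.card H).Prime := ⟨hcard ▸ Nat.prime_two⟩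
  have hmax : ∀ K : Subgroup G, H < K → K = ⊤ := by
    intro K hK
    have h1 := Subgroup.relIndex_mul_index hK.le
    rw [hidx] at h1
    have h2 : H.relIndex K ≠ 1 := fun h => hK.not_ge (Subgroup.relIndex_eq_one.1 h)
    rcases (Nat.dvd_prime Nat.prime_three).1 (Dvd.intro _ h1) with h | h
    · exact absurd h h2
    · rw [h] at h1
      exact Subgroup.index_eq_one.1 (by omega)
  have hN : Subgroup.normalizer (H : Set G) = H := by
    by_contra hne
    have := hmax _ (lt_of_le_of_ne Subgroup.le_normalizer (Ne.symm hne))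
    exact hH.not_normal (Subgroup.normalizer_eq_top_iff.1 this)
  have hIio : Set.Iio H = {⊥} := by
    ext A
    simp only [Set.mem_Iio, Set.mem_singleton_iff]
    refine ⟨fun hA => ?_, fun h => h ▸ bot_lt_iff_ne_bot.2 hH.ne_bot⟩
    rcases (A.subgroupOf H).eq_bot_or_eq_top_of_prime_card with h | h
    · rw [Subgroup.subgroupOf_eq_bot] at h
      exact disjoint_self.1 (h.mono_right hA.le)
    · exact absurd (Subgroup.subgroupOf_eq_top.1 h) hA.not_ge
  have hlt : permCount H < Nat.card (Subgroup G) := by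
    rw [← Set.ncard_univ]
    refine Set.ncard_lt_ncard (Set.ssubset_univ_iff.2 fun huniv => ?_)
    -- If `H` permuted with another conjugate `B`, the set HB would be a subgroup properly
    -- containing `H`, hence all six elements, yet it has at most 2 · 2 = 4.
    obtain ⟨B, hB, hne⟩ : ∃ B ∈ {K : Subgroup G | ¬ K.Normal}, B ≠ H := by
      apply Set.exists_ne_of_one_lt_ncard
      rw [hH.ncard_not_normal hN, hidx]
      norm_num
    have hcomm : B ∈ {B : Subgroup G | (H : Set G) * B = B * H} := huniv ▸ trivial
    have hsup : H ⊔ B = ⊤ := by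
      refine hmax _ (lt_of_le_of_ne le_sup_left fun h => hne ?_)
      exact Subgroup.eq_of_le_of_card_ge (sup_eq_left.1 h.symm) (hH.card_eq hB).ge
    have hset := coe_sup_of_mul_comm hcomm
    have h6 : ((H : Set G) * B).ncard = 6 := by
      rw [← hset, hsup, Subgroup.coe_top, Set.ncard_univ, hG]
    have h4 : ((H : Set G) * B).ncard ≤ Nat.card H * Nat.card B := Set.natCard_mul_le
    rw [hH.card_eq hB, hcard] at h4
    omega
  -- The bound 2n + 1 = 3 is attained by `⊥`, `⊤` and the complement of order 3.
  have hnorm : {K : Subgroup G | K.Normal}.ncard = 3 := by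
    have hle := hH.ncard_normal_le hN
    rw [hIio, Set.ncard_singleton] at hle
    refine le_antisymm hle ?_
    obtain ⟨N, hNn, hcomp, -, -⟩ := hH.exists_complement hN
    have hcN := hcomp.index_eq_card
    rw [hidx] at hcN
    have hsub : {⊥, ⊤, N} ⊆ {K : Subgroup G | K.Normal} := by
      rintro K (rfl | rfl | rfl)
      · exact (inferInstance : (⊥ : Subgroup G).Normal)
      · exact (inferInstance : (⊤ : Subgroup G).Normal)
      · exact hNn
    refine le_trans (Eq.ge ?_) (Set.ncard_le_ncard hsub)
    rw [Set.ncard_eq_three]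
    refine ⟨⊥, ⊤, N, ?_, ?_, ?_, rfl⟩
    · intro h
      have := congrArg (fun K : Subgroup G => Nat.card K) h
      simp [hG] at this
    · rintro rfl
      simp at hcN
    · rintro rfl
      simp [hG] at hcN
  have heq : sd H = sd (⊤ : Subgroup G) := by
    rw [hH.sd_eq_sd_top_iff hlt, ← ncard_normal_add_ncard_not_normal, hnorm,
      hH.ncard_not_normal hN, hidx, hIio, Set.ncard_singleton]
  exact ⟨hmax, heq, fun h => hlt.ne (hH.sd_top_eq_one_iff.1 h)⟩

theorem hasTwoDegrees_of_card_eq_six (hH : IsUniqueNonnormal H) (hG : Nat.card G = 6) :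
    HasTwoDegrees G := by
  have hne := (hH.sd_eq_of_card_eq_six hG).2.2
  refine ⟨inferInstance, Set.ncard_eq_two.2 ⟨1, sd (⊤ : Subgroup G), hne.symm, ?_⟩⟩
  ext x
  constructor
  · rintro ⟨K, rfl⟩
    by_cases h : ∀ A ≤ K, A.Normal
    · exact Or.inl (sd_eq_one h)
    right
    push Not at h
    obtain ⟨A, hAK, hA⟩ := h
    -- With `A` as the class representative, maximality of `A` leaves only `K = A` or `K = ⊤`, which
    -- have the same degree.
    obtain ⟨hmax, heq, -⟩ := (hH.of_not_normal hA).sd_eq_of_card_eq_six hG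
    rcases hAK.eq_or_lt with rfl | hlt
    · exact heq
    · rw [hmax K hlt]; rfl
  · rintro (rfl | rfl)
    · exact ⟨⊥, sd_eq_one fun A hA => by rw [le_bot_iff.1 hA]; infer_instance⟩
    · exact ⟨⊤, rfl⟩

end Finite

end SubgroupCommutativity

open SubgroupCommutativity in
theorem theorem2p3 (G : Type*) [Group G] [Finite G]
    (hG : SubgroupCommutativity.gamma G = 1) :
    SubgroupCommutativity.HasTwoDegrees G ↔ Nonempty (G ≃* Equiv.Perm (Fin 3)) := by
  obtain ⟨H, hH⟩ := exists_isUniqueNonnormal hG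
  refine ⟨nonempty_mulEquiv_perm_of_hasTwoDegrees hH, fun ⟨e⟩ => ?_⟩
  refine hasTwoDegrees_of_card_eq_six hH ?_
  rw [Nat.card_congr e.toEquiv, Nat.card_perm, Nat.card_eq_fintype_card, Fintype.card_fin]
  rfl
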